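/- Let $\Omega=\mathbb R\times(0,\pi)$. Let $V(\Omega)\subset L^2(\Omega)$ be the closure of $C_0^\infty(\Omega)$ for the norm $|g|_V=\big(\int_\Omega (|\partial_x g|^2+x^2|\partial_y g|^2)\,dx\,dy\big)^{1/2}$. For $\omega\subset\Omega$ open, $T>0$, $g_0\in L^2(\Omega)$ and $u\in L^2((0,T)\times\Omega)$, consider the Grushin equation $$(\partial_t-\partial_x^2-x^2\partial_y^2)g=\mathbf 1_\omega u \text{ on } (0,T)\times\Omega,\qquad g=0 \text{ on } (0,T)\times\partial\Omega,\qquad g(0)=g_0,$$ where the solution $g\in C([0,T];L^2(\Omega))\cap L^2(0,T;V(\Omega))$ is understood in the weak sense: for all $\varphi\in C_0^\infty(\Omega)$ and all $t\in[0,T]$, $$\int_\Omega g(t)\varphi-\int_\Omega g_0\varphi+\int_0^t\!\!\int_\Omega(\partial_xg\,\partial_x\varphi+x^2\partial_yg\,\partial_y\varphi)\,dx\,dy\,ds=\int_0^t\!\!\int_\omega u\varphi\,dx\,dy\,ds .$$ The equation is called null-controllable on $\omega$ in time $T$ if for each $g_0\in L^2(\Omega)$ there is a control $u\in L^2((0,T)\times\Omega)$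 such that the solution $g$ satisfies $g(T)=0$. (Functions may be real- or complex-valued throughout.) **Theorem.** Let $y_0\in(0,\pi)$, let $f\colon\mathbb R\to(0,+\infty)$ be continuous, and let $\omega=\{(x,y)\in\mathbb R\times(0,\pi): |y-y_0|>f(x)\}$. Then, for every $T>0$, the Grushin equation on $\Omega=\mathbb R\times(0,\pi)$ is not null-controllable on $\omega$ in time $T$. -/

import Mathlib

open MeasureTheory

noncomputable section

namespace Grushin

/-- The domain `Ω = ℝ × (0, π)`; a point is `p = (x, y)`, with `x = p.1` and `y = p.2`. -/
def strip : Set (ℝ × ℝ) := {p | p.2 ∈ Set.Ioo 0 Real.pi}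

/-- The Lebesgue space `L²(Ω)` of `𝕜`-valued functions (`𝕜` is `ℝ` or `ℂ`). -/
abbrev L2 (𝕜 : Type*) [RCLike 𝕜] : Type _ :=
  Lp 𝕜 2 ((volume : Measure (ℝ × ℝ)).restrict strip)

/-- `φ ∈ C₀^∞(Ω)`: a smooth function on the plane with compact support contained in `Ω`. -/
structure IsTest {𝕜 : Type*} [RCLike 𝕜] (φ : ℝ × ℝ → 𝕜) : Prop where
  smooth : ContDiff ℝ ((⊤ : ℕ∞) : WithTop ℕ∞) φ
  compact : HasCompactSupport φ
  support : tsupport φ ⊆ strip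

/-- `∂ₓ φ`. -/
def dx {𝕜 : Type*} [RCLike 𝕜] (φ : ℝ × ℝ → 𝕜) (p : ℝ × ℝ) : 𝕜 :=
  fderiv ℝ φ p (1, 0)

/-- `x ∂_y φ`. -/
def xdy {𝕜 : Type*} [RCLike 𝕜] (φ : ℝ × ℝ → 𝕜) (p : ℝ × ℝ) : 𝕜 :=
  p.1 • fderiv ℝ φ p (0, 1)

/-- The space `V(Ω)`, the closure of `C₀^∞(Ω)` for the norm
`|g|_V² = ∫_Ω (|∂ₓ g|² + |x ∂_y g|²)`, each element being recorded together with its degenerate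
gradient: `(g, P, Q)` belongs to this set if and only if there are test functions `φₙ` with
`φₙ → g`, `∂ₓ φₙ → P` and `x ∂_y φₙ → Q` in `L²(Ω)`, so that `g ∈ V(Ω)`, `P = ∂ₓ g` and
`Q = x ∂_y g`. On the strip `|φ|_{L²} ≤ |φ|_V` for all test functions, so that convergence
of `φₙ` in `L²(Ω)` is automatic for a Cauchy sequence for `|·|_V`. -/
def VGraph (𝕜 : Type*) [RCLike 𝕜] : Set (L2 𝕜 × L2 𝕜 × L2 𝕜) :=
  closure {w | ∃ φ : ℝ × ℝ → 𝕜, IsTest φ ∧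
    w.1 =ᵐ[volume.restrict strip] φ ∧
    w.2.1 =ᵐ[volume.restrict strip] dx φ ∧
    w.2.2 =ᵐ[volume.restrict strip] xdy φ}

/-- `f` is a weak solution on `[0, T]`, in `C([0,T]; L²(Ω)) ∩ L²(0,T; V(Ω))`, of
`(∂ₜ - ∂ₓ² - x² ∂_y²) f = 1_ω u` with the Dirichlet boundary condition and `f(0) = f₀`.
Here `P = ∂ₓ f` and `Q = x ∂_y f`. -/
def IsWeakSolution {𝕜 : Type*} [RCLike 𝕜] (T : ℝ) (ω : Set (ℝ × ℝ)) (f₀ : L2 𝕜)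
    (u : ℝ → ℝ × ℝ → 𝕜) (f : ℝ → L2 𝕜) : Prop :=
  ContinuousOn f (Set.Icc 0 T) ∧ f 0 = f₀ ∧
  ∃ P Q : ℝ → L2 𝕜,
    MemLp P 2 (volume.restrict (Set.Ioo 0 T)) ∧
    MemLp Q 2 (volume.restrict (Set.Ioo 0 T)) ∧
    (∀ᵐ t ∂(volume.restrict (Set.Ioo 0 T)), (f t, P t, Q t) ∈ VGraph 𝕜) ∧
    ∀ φ : ℝ × ℝ → 𝕜, IsTest φ → ∀ t ∈ Set.Icc 0 T,
      (∫ p in strip, f t p * φ p) - (∫ p in strip, f₀ p * φ p) +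
        (∫ s in (0 : ℝ)..t, ∫ p in strip, (P s p * dx φ p + Q s p * xdy φ p)) =
      ∫ s in (0 : ℝ)..t, ∫ p in strip, ω.indicator (u s) p * φ p

/-- Null-controllability on `ω` in time `T`: each initial datum `f₀ ∈ L²(Ω)` is steered to `0`
at time `T` by some control `u ∈ L²((0,T) × Ω)` acting on `ω`. -/
def NullControllable (𝕜 : Type*) [RCLike 𝕜] (T : ℝ) (ω : Set (ℝ × ℝ)) : Prop :=
  ∀ f₀ : L2 𝕜, ∃ u : ℝ → ℝ × ℝ → 𝕜,
    MemLp (Function.uncurry u) 2 (volume.restrict (Set.Ioo 0 T ×ˢ strip)) ∧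
    ∃ f : ℝ → L2 𝕜, IsWeakSolution T ω f₀ u f ∧ f T = 0

/-- The control domain `ω = {(x, y) ∈ Ω : |y - y₀| > f(x)}`. -/
def controlDomain (y₀ : ℝ) (f : ℝ → ℝ) : Set (ℝ × ℝ) :=
  {p | p ∈ strip ∧ f p.1 < |p.2 - y₀|}

end Grushin

end

noncomputable section

namespace Grushin

/-! ### Polynomial separation, a scalar linear equation, and the slit disk -/

section PolynomialSeparation

/-! The functions `e^{-n x²/2} sin (n y)` are eigenfunctions of the Grushin operator with eigenvalue
`n`, so a control steering the solution to zero satisfies one moment identity for each `n`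
(`IsWeakSolution.re_pairing_mode`). Multiply the identity of index `i + 1` by `q_i e^{-(i+1)T}` and
sum over the coefficients of a polynomial `q`. Writing the sine with exponentials, the control is
then integrated against values of `z q(z)` at `z = exp (-τ - x²/2 ± i y)`, with `τ = T - t` and `(x,
y) ∈ ω`. Hence the weighted sum of the moments of the datum is at most `C` times the supremum of
`|q|` over these `z`, with `C` independent of `q` (`NullControllable.moment_estimate`).

If the moments are `v^n` with `v = w e^T` and `|w| < e^{-T}`, the weighted sum is `w q(w)`. It is
thus enough to find such a `w ≠ 0` and a polynomial `p` with `p(w) = 1` and `|p| ≤ 1/2` at all these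
`z`: taking `q = p^k` gives `|w| ≤ C 2^{-k}` for all `k`, which is absurd.

The points `z` lie in the unit disk, and they avoid a truncated sector around the direction `y₀`:
`f` is bounded below on bounded ranges of `x`, and large `|x|` only produces small `|z|`. The sector
may start as close to `0` as desired, so for every `T` it contains a `w` joined to infinity by a
ray, and a Runge type argument gives `p` (`exists_polynomial_small_on_control`). -/

open Polynomial in
/-- A point of the complement of a compact set `K` which is joined to infinity outside `K` is
separated from `K` by a polynomial. -/
theorem exists_polynomial_separating {K L : Set ℂ} (hK : IsCompact K) (hL : IsPreconnected L)
    (hLu : ¬ Bornology.IsBounded L) (hLK : L ⊆ Kᶜ) {w : ℂ} (hw : w ∈ L) :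
    ∃ p : ℂ[X], p.eval w = 1 ∧ ∀ z ∈ K, ‖p.eval z‖ ≤ 1 / 2 := by
  rcases K.eq_empty_or_nonempty with rfl | hne
  · exact ⟨1, by simp, by simp⟩
  have : CompactSpace K := isCompact_iff_compactSpace.1 hK
  have : Nonempty K := hne.to_subtype
  let S : Subalgebra ℂ C(K, ℂ) := (polynomialFunctions K).topologicalClosure
  have hSc : IsClosed (S : Set C(K, ℂ)) := (polynomialFunctions K).isClosed_topologicalClosure
  let x : S := ⟨toContinuousMapOnAlgHom K X, (polynomialFunctions K).le_topologicalClosure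
    ⟨X, by simp⟩⟩
  have hspec : spectrum ℂ (x : C(K, ℂ)) = K := by
    rw [ContinuousMap.spectrum_eq_range]
    ext z
    simp [x]
  -- In the uniform closure of the polynomials, the spectrum can only gain points from bounded
  -- components of the complement of `K`. The component of `w` contains the unbounded set `L`, so `w
  -- - X` is invertible there.
  have hwx : w ∉ spectrum ℂ x := by
    intro h
    have h1 := Subalgebra.spectrum_isBounded_connectedComponentIn S x h
    rw [hspec] at h1
    exact hLu (h1.subset (hL.subset_connectedComponentIn hw hLK))
  rw [spectrum.notMem_iff] at hwx
  obtain ⟨s, hs⟩ := hwx.exists_right_inv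
  obtain ⟨M, hM⟩ := hK.isBounded.exists_norm_le
  have hM0 : 0 ≤ M := (norm_nonneg _).trans (hM _ hne.some_mem)
  have hmem : (s : C(K, ℂ)) ∈ closure (polynomialFunctions K : Set C(K, ℂ)) := by
    have := s.2
    rwa [← Subalgebra.topologicalClosure_coe]
  -- On `K` one has `|w - z| ≤ ‖w‖ + M`, so this accuracy makes `1 - (w - X) q` at most `1/2`.
  obtain ⟨g, hg, hgs⟩ := Metric.mem_closure_iff.1 hmem (1 / (2 * (‖w‖ + M + 1))) (by positivity)
  obtain ⟨q, -, rfl⟩ := hg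
  refine ⟨1 - (C w - X) * q, by simp, fun z hz => ?_⟩
  have h1 := congrArg (fun t : S => (t : C(K, ℂ)) ⟨z, hz⟩) hs
  simp only [Subalgebra.coe_mul, ContinuousMap.mul_apply] at h1
  have h2 : (w - z) * (s : C(K, ℂ)) ⟨z, hz⟩ = 1 := by simpa [x] using h1
  have h3 := (ContinuousMap.dist_apply_le_dist (f := (s : C(K, ℂ)))
    (g := toContinuousMapOnAlgHom K q) ⟨z, hz⟩).trans hgs.le
  rw [dist_eq_norm] at h3
  have h4 : (1 - (C w - X) * q).eval z =
      (w - z) * ((s : C(K, ℂ)) ⟨z, hz⟩ - toContinuousMapOnAlgHom K q ⟨z, hz⟩) := by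
    rw [mul_sub, h2]; simp
  rw [h4, norm_mul]
  calc ‖w - z‖ * _ ≤ (‖w‖ + M + 1) * (1 / (2 * (‖w‖ + M + 1))) := by
        gcongr
        linarith [norm_sub_le w z, hM z hz]
    _ = 1 / 2 := by field_simp

/-- Solution formula for a scalar linear equation in integral form which ends at zero. -/
theorem eq_neg_integral_exp_mul {m b : ℝ → ℝ} {c T : ℝ} (hT : 0 ≤ T)
    (hm : IntervalIntegrable m volume 0 T) (hb : IntervalIntegrable b volume 0 T)
    (h : ∀ t ∈ Set.Icc 0 T, m t - m 0 + c * ∫ s in (0 : ℝ)..t, m s = ∫ s in (0 : ℝ)..t, b s)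
    (hmT : m T = 0) :
    m 0 = - ∫ s in (0 : ℝ)..T, Real.exp (c * s) * b s := by
  have hM := hm.absolutelyContinuousOnInterval_intervalIntegral (c := 0) (by simp)
  have hB := hb.absolutelyContinuousOnInterval_intervalIntegral (c := 0) (by simp)
  have hconst : AbsolutelyContinuousOnInterval (fun _ : ℝ => m 0) 0 T :=
    contDiff_const.contDiffOn.absolutelyContinuousOnInterval
  have hH := (hconst.sub (hM.const_mul c)).add hB
  -- `H` is an absolutely continuous function which agrees with `m` on `[0, T]`; the product rule is
  -- applied to `e^{ct} H`.
  set H : ℝ → ℝ := ((fun _ => m 0) - fun t => c * ∫ s in (0 : ℝ)..t, m s) +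
    fun t => ∫ s in (0 : ℝ)..t, b s with hHdef
  have hHm : ∀ t ∈ Set.Icc 0 T, H t = m t := by
    intro t ht
    have := h t ht
    simp only [hHdef, Pi.add_apply, Pi.sub_apply]
    linarith
  have hE : AbsolutelyContinuousOnInterval (fun t => Real.exp (c * t)) 0 T :=
    ContDiffOn.absolutelyContinuousOnInterval (by fun_prop)
  have key := hE.integral_deriv_mul_eq_sub hH
  rw [hHm T ⟨hT, le_rfl⟩, hHm 0 ⟨le_rfl, hT⟩, hmT] at key
  have hcongr : ∫ t in (0 : ℝ)..T, (deriv (fun t => Real.exp (c * t)) t * H t +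
      Real.exp (c * t) * deriv H t) = ∫ t in (0 : ℝ)..T, Real.exp (c * t) * b t := by
    apply intervalIntegral.integral_congr_ae
    filter_upwards [hm.ae_hasDerivAt_integral, hb.ae_hasDerivAt_integral] with t h1 h2 ht
    have htI : t ∈ Set.uIcc 0 T := Set.uIoc_subset_uIcc ht
    have h3 := h1 htI 0 (by simp)
    have h4 := h2 htI 0 (by simp)
    have h5 : HasDerivAt H (0 - c * m t + b t) t :=
      ((hasDerivAt_const t (m 0)).sub (h3.const_mul c)).add h4
    have h6 : HasDerivAt (fun t => Real.exp (c * t)) (Real.exp (c * t) * (c * 1)) t :=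
      ((hasDerivAt_id t).const_mul c).exp
    rw [h5.deriv, h6.deriv, hHm t (by rwa [Set.uIcc_of_le hT] at htI)]
    ring
  rw [hcongr] at key
  simp at key
  linarith

/-- A compact set avoiding a radial half-line in the direction `y₀`. -/
def slitDisk (y₀ ρ ε : ℝ) : Set ℂ :=
  {z | ‖z‖ ≤ 1 ∧ (‖z‖ ≤ ρ ∨ (z * Complex.exp (-(y₀ * Complex.I))).re ≤ ‖z‖ * Real.cos ε)}

theorem isCompact_slitDisk (y₀ ρ ε : ℝ) : IsCompact (slitDisk y₀ ρ ε) := by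
  apply Metric.isCompact_of_isClosed_isBounded
  · have h1 : IsClosed {z : ℂ | ‖z‖ ≤ 1} := isClosed_le (by fun_prop) (by fun_prop)
    have h2 : IsClosed {z : ℂ | ‖z‖ ≤ ρ} := isClosed_le (by fun_prop) (by fun_prop)
    have h3 : IsClosed {z : ℂ | (z * Complex.exp (-(y₀ * Complex.I))).re ≤ ‖z‖ * Real.cos ε} :=
      isClosed_le (by fun_prop) (by fun_prop)
    exact h1.inter (h2.union h3)
  · exact (Metric.isBounded_closedBall (x := (0 : ℂ)) (r := 1)).subset fun z hz => by
      simpa using hz.1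

theorem exp_mem_slitDisk {y₀ ρ ε r y : ℝ} (hr : r ≤ 0)
    (h : Real.exp r ≤ ρ ∨ Real.cos (y - y₀) ≤ Real.cos ε) :
    Complex.exp (r + y * Complex.I) ∈ slitDisk y₀ ρ ε := by
  have hn : ‖Complex.exp (r + y * Complex.I)‖ = Real.exp r := by simp [Complex.norm_exp]
  refine ⟨by rw [hn]; simpa using hr, ?_⟩
  rw [hn]
  refine h.imp id fun h => ?_
  rw [← Complex.exp_add, Complex.exp_re]
  simp only [Complex.add_re, Complex.neg_re, Complex.add_im, Complex.neg_im, Complex.ofReal_re,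
    Complex.ofReal_im, Complex.mul_re, Complex.mul_im, Complex.I_re, Complex.I_im]
  simp only [mul_zero, mul_one, sub_zero, add_zero, neg_zero, zero_add, ← sub_eq_add_neg]
  gcongr

theorem ray_subset_compl_slitDisk {y₀ ρ ε r : ℝ} (hρ : ρ < r) (hρ0 : 0 ≤ ρ) (hε : Real.cos ε < 1) :
    (fun c : ℝ => (c : ℂ) * Complex.exp (y₀ * Complex.I)) '' Set.Ici r ⊆
      (slitDisk y₀ ρ ε)ᶜ := by
  rintro _ ⟨c, hc, rfl⟩ ⟨-, h⟩
  have hc : r ≤ c := hc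
  have hn : ‖(c : ℂ) * Complex.exp (y₀ * Complex.I)‖ = c := by
    rw [norm_mul, Complex.norm_exp_ofReal_mul_I, mul_one, Complex.norm_real, Real.norm_of_nonneg
      (by linarith)]
  simp only [hn] at h
  rcases h with h | h
  · linarith
  · rw [mul_assoc, ← Complex.exp_add] at h
    simp at h
    nlinarith

/-- The radii are `ρ = e^{-(T+2)} < ‖w‖ = e^{-(T+1)} < e^{-T}`. Both signs of `y` are needed because
the sine involves `z` and its conjugate. -/
theorem exists_polynomial_small_on_control {y₀ : ℝ} (hy₀ : y₀ ∈ Set.Ioo 0 Real.pi) {f : ℝ → ℝ}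
    (hf : Continuous f) (hpos : ∀ x, 0 < f x) {T : ℝ} (hT : 0 < T) :
    ∃ (w : ℂ) (p : Polynomial ℂ), w ≠ 0 ∧ ‖w‖ < Real.exp (-T) ∧ p.eval w = 1 ∧
      ∀ τ, 0 ≤ τ → ∀ q ∈ controlDomain y₀ f, ∀ y, (y = q.2 ∨ y = -q.2) →
        ‖p.eval (Complex.exp ((-τ - q.1 ^ 2 / 2 : ℝ) + y * Complex.I))‖ ≤ 1 / 2 := by
  obtain ⟨hy1, hy2⟩ := hy₀
  -- Beyond this interval `x²/2 ≥ (T+2)²/2 ≥ T + 2`, so `|z| ≤ ρ` whatever `f` is.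
  obtain ⟨x₀, -, hx₀⟩ := (isCompact_Icc (a := -(T + 2)) (b := T + 2)).exists_isMinOn
    ⟨0, by constructor <;> linarith⟩ hf.continuousOn
  -- The bounds by `y₀` and `π - y₀` keep the reflected angle `-y` at distance at least `ε` from
  -- `y₀` modulo `2π`.
  set ε := min (f x₀) (min y₀ (Real.pi - y₀)) with hε
  have hε0 : 0 < ε := by
    simp only [hε, lt_min_iff]
    exact ⟨hpos _, hy1, by linarith⟩
  have hεf : ε ≤ f x₀ := min_le_left _ _
  have hεy : ε ≤ y₀ := (min_le_right _ _).trans (min_le_left _ _)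
  have hεπ : ε ≤ Real.pi - y₀ := (min_le_right _ _).trans (min_le_right _ _)
  have hcos : Real.cos ε < 1 := by
    have := Real.cos_lt_cos_of_nonneg_of_le_pi le_rfl (by linarith : ε ≤ Real.pi) hε0
    simpa using this
  set ρ := Real.exp (-(T + 2)) with hρ
  have hρr : ρ < Real.exp (-(T + 1)) := Real.exp_lt_exp.2 (by linarith)
  set ray : ℝ → ℂ := fun c => (c : ℂ) * Complex.exp (y₀ * Complex.I) with hray
  have hrayn : ∀ c : ℝ, ‖ray c‖ = |c| := fun c => by
    simp only [hray]
    rw [norm_mul, Complex.norm_exp_ofReal_mul_I, mul_one, Complex.norm_real, Real.norm_eq_abs]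
  obtain ⟨p, hp1, hp2⟩ := exists_polynomial_separating (isCompact_slitDisk y₀ ρ ε)
    (L := ray '' Set.Ici (Real.exp (-(T + 1))))
    (isPreconnected_Ici.image _ (by fun_prop)) (by
      intro hb
      obtain ⟨M, hM⟩ := hb.exists_norm_le
      have := hM _ ⟨max (Real.exp (-(T + 1))) (M + 1), Set.mem_Ici.2 (le_max_left _ _), rfl⟩
      rw [hrayn] at this
      linarith [le_abs_self (max (Real.exp (-(T + 1))) (M + 1)),
        le_max_right (Real.exp (-(T + 1))) (M + 1)])
    (ray_subset_compl_slitDisk hρr (Real.exp_pos _).le hcos)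
    (w := ray (Real.exp (-(T + 1)))) ⟨_, Set.mem_Ici.2 le_rfl, rfl⟩
  refine ⟨_, p, ?_, ?_, hp1, fun τ hτ q hq y hy => hp2 _ (exp_mem_slitDisk ?_ ?_)⟩
  · rw [← norm_ne_zero_iff, hrayn]; positivity
  · rw [hrayn, abs_of_pos (Real.exp_pos _)]
    exact Real.exp_lt_exp.2 (by linarith)
  · nlinarith [sq_nonneg q.1]
  obtain ⟨⟨hq1, hq2⟩, hq3⟩ := hq
  by_cases hx : q.1 ∈ Set.Icc (-(T + 2)) (T + 2)
  · right
    have h1 : ε < |q.2 - y₀| := hεf.trans_lt ((hx₀ hx).trans_lt hq3)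
    rcases hy with rfl | rfl
    · rw [← Real.cos_abs]
      exact Real.cos_le_cos_of_nonneg_of_le_pi hε0.le (abs_le.2 ⟨by linarith, by linarith⟩) h1.le
    · rw [← Real.cos_neg, show -(-q.2 - y₀) = q.2 + y₀ by ring]
      rcases le_total (q.2 + y₀) Real.pi with h | h
      · exact Real.cos_le_cos_of_nonneg_of_le_pi hε0.le h (by linarith)
      · rw [← Real.cos_two_pi_sub]
        exact Real.cos_le_cos_of_nonneg_of_le_pi hε0.le (by linarith) (by linarith)
  · left
    refine Real.exp_le_exp.2 ?_
    rw [Set.mem_Icc, ← abs_le, not_le] at hx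
    have : (T + 2) ^ 2 ≤ q.1 ^ 2 := by
      rw [← sq_abs q.1]; gcongr
    nlinarith

end PolynomialSeparation

/-! ### Eigenfunctions and their energy identity -/

section Modes

open scoped ContDiff Topology
open Filter

/-- Lebesgue measure on the strip. -/
abbrev vol : Measure (ℝ × ℝ) := (volume : Measure (ℝ × ℝ)).restrict strip

theorem isOpen_strip : IsOpen strip := isOpen_Ioo.preimage continuous_snd

theorem measurableSet_strip : MeasurableSet strip := isOpen_strip.measurableSet

theorem vol_eq_prod :
    vol = (volume : Measure ℝ).prod (volume.restrict (Set.Ioo 0 Real.pi)) := by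
  have : strip = Set.univ ×ˢ Set.Ioo 0 Real.pi := by ext; simp [strip]
  rw [vol, this, Measure.volume_eq_prod, ← Measure.prod_restrict, Measure.restrict_univ]

theorem hasFDerivAt_mul_prod {a b : ℝ → ℝ} {a' b' : ℝ} {p : ℝ × ℝ} (ha : HasDerivAt a a' p.1)
    (hb : HasDerivAt b b' p.2) :
    HasFDerivAt (fun p : ℝ × ℝ => a p.1 * b p.2)
      ((a' * b p.2) • ContinuousLinearMap.fst ℝ ℝ ℝ +
        (a p.1 * b') • ContinuousLinearMap.snd ℝ ℝ ℝ) p := by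
  have h1 : HasFDerivAt (fun p : ℝ × ℝ => a p.1) (a' • ContinuousLinearMap.fst ℝ ℝ ℝ) p :=
    ha.comp_hasFDerivAt (f := Prod.fst) p hasFDerivAt_fst
  have h2 : HasFDerivAt (fun p : ℝ × ℝ => b p.2) (b' • ContinuousLinearMap.snd ℝ ℝ ℝ) p :=
    hb.comp_hasFDerivAt (f := Prod.snd) p hasFDerivAt_snd
  refine (h1.mul h2).congr_fderiv ?_
  ext
  · simp; ring
  · simp

theorem hasDerivAt_gauss (c x : ℝ) :
    HasDerivAt (fun x : ℝ => Real.exp (-(c * x ^ 2 / 2))) (-(c * x) * Real.exp (-(c * x ^ 2 / 2)))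
      x := by
  have h : HasDerivAt (fun x : ℝ => -(c * x ^ 2 / 2)) (-(c * (2 * x) / 2)) x := by
    have := (((hasDerivAt_pow 2 x).const_mul c).div_const 2).neg
    norm_num at this
    exact this
  convert h.exp using 1
  ring

/-- The eigenfunction `e^{-n x² / 2} sin (n y)` of the Grushin operator. -/
def mode (n : ℕ) (p : ℝ × ℝ) : ℝ := Real.exp (-(n * p.1 ^ 2 / 2)) * Real.sin (n * p.2)

/-- The derivative of `mode n` in `x`. -/
def modeDx (n : ℕ) (p : ℝ × ℝ) : ℝ :=
  -(n * p.1) * Real.exp (-(n * p.1 ^ 2 / 2)) * Real.sin (n * p.2)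

/-- The derivative of `mode n` in `y`. -/
def modeDy (n : ℕ) (p : ℝ × ℝ) : ℝ :=
  Real.exp (-(n * p.1 ^ 2 / 2)) * (n * Real.cos (n * p.2))

theorem hasDerivAt_sin_mul (c y : ℝ) :
    HasDerivAt (fun y => Real.sin (c * y)) (c * Real.cos (c * y)) y := by
  simpa [mul_comm] using ((hasDerivAt_id y).const_mul c).sin

theorem hasDerivAt_cos_mul (c y : ℝ) :
    HasDerivAt (fun y => c * Real.cos (c * y)) (-(c ^ 2 * Real.sin (c * y))) y := by
  have h : HasDerivAt (fun y => c * y) c y := by simpa using (hasDerivAt_id y).const_mul c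
  exact (h.cos.const_mul c).congr_deriv (by ring)

theorem hasFDerivAt_mode (n : ℕ) (p : ℝ × ℝ) :
    HasFDerivAt (mode n) (modeDx n p • ContinuousLinearMap.fst ℝ ℝ ℝ +
      modeDy n p • ContinuousLinearMap.snd ℝ ℝ ℝ) p :=
  hasFDerivAt_mul_prod (hasDerivAt_gauss n p.1) (hasDerivAt_sin_mul n p.2)

theorem contDiff_mode (n : ℕ) : ContDiff ℝ ω (mode n) := by
  unfold mode
  exact ((((contDiff_const.mul (contDiff_fst.pow 2)).div_const 2).neg).exp).mul
    (contDiff_const.mul contDiff_snd).sin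

theorem continuous_mode (n : ℕ) : Continuous (mode n) := (contDiff_mode n).continuous

section MemLp

variable {𝕜 : Type*} [RCLike 𝕜]

theorem memLp_mul_prod {a b : ℝ → ℝ} (ha : Continuous a) (ha2 : Integrable fun x => a x ^ 2)
    (hb : Continuous b) :
    MemLp (fun p : ℝ × ℝ => ((a p.1 * b p.2 : ℝ) : 𝕜)) 2 vol := by
  have hc : Continuous fun p : ℝ × ℝ => a p.1 * b p.2 := by fun_prop
  refine MemLp.ofReal ((memLp_two_iff_integrable_sq hc.aestronglyMeasurable).2 ?_)
  simp only [mul_pow]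
  rw [vol_eq_prod]
  refine ha2.mul_prod (g := fun y => b y ^ 2) ?_
  have : IntegrableOn (fun y => b y ^ 2) (Set.Icc 0 Real.pi) :=
    (hb.pow 2).integrableOn_Icc
  exact this.mono_set Set.Ioo_subset_Icc_self

theorem integrable_gauss_sq {c : ℝ} (hc : 0 < c) :
    Integrable fun x : ℝ => Real.exp (-(c * x ^ 2 / 2)) ^ 2 := by
  refine (integrable_exp_neg_mul_sq hc).congr (Eventually.of_forall fun x => ?_)
  simp only [← Real.exp_nat_mul]
  congr 1; push_cast; ring

theorem integrable_mul_gauss_sq {c : ℝ} (hc : 0 < c) :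
    Integrable fun x : ℝ => (x * Real.exp (-(c * x ^ 2 / 2))) ^ 2 := by
  refine (integrable_rpow_mul_exp_neg_mul_sq hc (s := 2) (by norm_num)).congr
    (Eventually.of_forall fun x => ?_)
  simp only [mul_pow, ← Real.exp_nat_mul]
  norm_num
  left; ring

theorem memLp_mode {n : ℕ} (hn : 0 < n) : MemLp (fun p => (mode n p : 𝕜)) 2 vol :=
  memLp_mul_prod (a := fun x => Real.exp (-(n * x ^ 2 / 2))) (b := fun y => Real.sin (n * y))
    (by fun_prop) (integrable_gauss_sq (Nat.cast_pos.2 hn)) (by fun_prop)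

theorem memLp_modeDx {n : ℕ} (hn : 0 < n) : MemLp (fun p => (modeDx n p : 𝕜)) 2 vol := by
  refine (memLp_mul_prod (𝕜 := 𝕜) (a := fun x => x * Real.exp (-(n * x ^ 2 / 2)))
    (b := fun y => -n * Real.sin (n * y))
    (by fun_prop) (integrable_mul_gauss_sq (Nat.cast_pos.2 hn)) (by fun_prop)).ae_eq
    (Eventually.of_forall fun p => ?_)
  simp only [modeDx]
  congr 1; ring

theorem memLp_mul_modeDy {n : ℕ} (hn : 0 < n) :
    MemLp (fun p => ((p.1 * modeDy n p : ℝ) : 𝕜)) 2 vol := by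
  refine (memLp_mul_prod (𝕜 := 𝕜) (a := fun x => x * Real.exp (-(n * x ^ 2 / 2)))
    (b := fun y => n * Real.cos (n * y))
    (by fun_prop) (integrable_mul_gauss_sq (Nat.cast_pos.2 hn)) (by fun_prop)).ae_eq
    (Eventually.of_forall fun p => ?_)
  simp only [modeDy]
  congr 1; ring

end MemLp

section Pairing

variable {𝕜 : Type*} [RCLike 𝕜] {α : Type*} [MeasurableSpace α] {μ : Measure α}

/-- The bilinear pairing with a square integrable function, as a continuous linear form. -/
def pairing (h : α → 𝕜) (hh : MemLp h 2 μ) : Lp 𝕜 2 μ →L[𝕜] 𝕜 := innerSL 𝕜 hh.star.toLp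

theorem pairing_apply {h : α → 𝕜} (hh : MemLp h 2 μ) (F : Lp 𝕜 2 μ) :
    pairing h hh F = ∫ p, F p * h p ∂μ := by
  rw [pairing, innerSL_apply_apply, L2.inner_def]
  refine integral_congr_ae ?_
  filter_upwards [hh.star.coeFn_toLp] with p hp
  rw [hp]
  simp

theorem integrable_mul_of_memLp (F : Lp 𝕜 2 μ) {h : α → 𝕜} (hh : MemLp h 2 μ) :
    Integrable (fun p => F p * h p) μ := (Lp.memLp F).integrable_mul hh

end Pairing

section Eigen

variable {𝕜 : Type*} [RCLike 𝕜]

theorem hasFDerivAt_ofReal {E : Type*} [NormedAddCommGroup E] [NormedSpace ℝ E] {g : E → ℝ}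
    {g' : E →L[ℝ] ℝ} {p : E} (h : HasFDerivAt g g' p) :
    HasFDerivAt (fun p => (g p : 𝕜)) (RCLike.ofRealCLM.comp g') p :=
  RCLike.ofRealCLM.hasFDerivAt.comp p h

theorem fderiv_modeDx (n : ℕ) (p : ℝ × ℝ) :
    fderiv ℝ (modeDx n) p (1, 0) = (n ^ 2 * p.1 ^ 2 - n) * mode n p := by
  have h1 : HasDerivAt (fun x : ℝ => -(n * x)) (-n : ℝ) p.1 := by
    simpa using ((hasDerivAt_id p.1).const_mul (n : ℝ)).fun_neg
  have h2 : HasFDerivAt (modeDx n) _ p := hasFDerivAt_mul_prod (h1.mul (hasDerivAt_gauss n p.1))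
    (hasDerivAt_sin_mul n p.2)
  rw [h2.fderiv]
  simp [mode]
  ring

theorem fderiv_sq_mul_modeDy (n : ℕ) (p : ℝ × ℝ) :
    fderiv ℝ (fun p : ℝ × ℝ => p.1 ^ 2 * modeDy n p) p (0, 1) = -(n ^ 2 * p.1 ^ 2 * mode n p) := by
  have h0 : (fun p : ℝ × ℝ => p.1 ^ 2 * modeDy n p) = fun p : ℝ × ℝ =>
      ((fun x : ℝ => x ^ 2) * fun x : ℝ => Real.exp (-(n * x ^ 2 / 2))) p.1 *
        (n * Real.cos (n * p.2)) := by
    funext p; simp only [modeDy, Pi.mul_apply]; ring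
  rw [h0, (hasFDerivAt_mul_prod ((hasDerivAt_pow 2 p.1).mul (hasDerivAt_gauss n p.1))
    (hasDerivAt_cos_mul n p.2)).fderiv]
  simp [mode]
  ring

theorem IsTest.integral_mul_fderiv {φ : ℝ × ℝ → 𝕜} (hφ : IsTest φ) {g : ℝ × ℝ → ℝ}
    (hg : ContDiff ℝ 1 g) (v : ℝ × ℝ) :
    ∫ p in strip, fderiv ℝ φ p v * (g p : 𝕜) = - ∫ p in strip, φ p * ((fderiv ℝ g p v : ℝ) : 𝕜) := by
  have hG : ContDiff ℝ 1 fun p => (g p : 𝕜) := (RCLike.ofRealCLM (K := 𝕜)).contDiff.comp hg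
  have hGd : ∀ p, fderiv ℝ (fun p => (g p : 𝕜)) p v = ((fderiv ℝ g p v : ℝ) : 𝕜) := fun p => by
    rw [(hasFDerivAt_ofReal (hg.differentiable (by simp) p).hasFDerivAt).fderiv]; rfl
  have hφ1 : ContDiff ℝ 1 φ := hφ.smooth.of_le (by exact_mod_cast le_top)
  have hφc : Continuous fun p => fderiv ℝ φ p v :=
    (hφ1.continuous_fderiv (by simp)).clm_apply continuous_const
  have hgc : Continuous fun p => fderiv ℝ (fun p => (g p : 𝕜)) p v :=
    (hG.continuous_fderiv (by simp)).clm_apply continuous_const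
  have key := integral_mul_fderiv_eq_neg_fderiv_mul_of_integrable (μ := (volume : Measure (ℝ × ℝ)))
    (f := φ) (g := fun p => (g p : 𝕜)) (v := v)
    ((hφc.mul hG.continuous).integrable_of_hasCompactSupport
      ((hφ.compact.fderiv_apply (𝕜 := ℝ) v).mul_right))
    ((hφ1.continuous.mul hgc).integrable_of_hasCompactSupport hφ.compact.mul_right)
    ((hφ1.continuous.mul hG.continuous).integrable_of_hasCompactSupport hφ.compact.mul_right)
    (fun p _ => hφ1.differentiable (by simp) p) (fun p _ => hG.differentiable (by simp) p)
  simp only [hGd] at key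
  have hz : ∀ p, p ∉ strip → p ∉ tsupport φ := fun p hp h => hp (hφ.support h)
  rw [setIntegral_eq_integral_of_forall_compl_eq_zero,
    setIntegral_eq_integral_of_forall_compl_eq_zero, key, neg_neg]
  · intro p hp
    simp [image_eq_zero_of_notMem_tsupport (hz p hp)]
  · intro p hp
    have h1 : p ∉ tsupport (fun p => fderiv ℝ φ p v) := fun h =>
      hz p hp (tsupport_fderiv_apply_subset ℝ v h)
    rw [image_eq_zero_of_notMem_tsupport h1, zero_mul]

theorem IsTest.continuous {φ : ℝ × ℝ → 𝕜} (hφ : IsTest φ) : Continuous φ := hφ.smooth.continuous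

theorem IsTest.memLp {φ : ℝ × ℝ → 𝕜} (hφ : IsTest φ) : MemLp φ 2 vol :=
  (hφ.continuous.memLp_of_hasCompactSupport hφ.compact).restrict _

theorem IsTest.continuous_fderiv {φ : ℝ × ℝ → 𝕜} (hφ : IsTest φ) (v : ℝ × ℝ) :
    Continuous fun p => fderiv ℝ φ p v :=
  (hφ.smooth.continuous_fderiv (by simp)).clm_apply continuous_const

theorem IsTest.memLp_dx {φ : ℝ × ℝ → 𝕜} (hφ : IsTest φ) : MemLp (dx φ) 2 vol :=
  ((hφ.continuous_fderiv (1, 0)).memLp_of_hasCompactSupport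
    (hφ.compact.fderiv_apply (𝕜 := ℝ) (1, 0))).restrict _

theorem IsTest.memLp_xdy {φ : ℝ × ℝ → 𝕜} (hφ : IsTest φ) : MemLp (xdy φ) 2 vol :=
  (Continuous.memLp_of_hasCompactSupport
    (continuous_fst.smul (hφ.continuous_fderiv (0, 1)))
    (HasCompactSupport.smul_left (hφ.compact.fderiv_apply (𝕜 := ℝ) (0, 1)))).restrict _

theorem contDiff_modeDx (n : ℕ) : ContDiff ℝ 1 (modeDx n) := by
  unfold modeDx; fun_prop

theorem contDiff_sq_mul_modeDy (n : ℕ) : ContDiff ℝ 1 fun p : ℝ × ℝ => p.1 ^ 2 * modeDy n p := by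
  unfold modeDy; fun_prop

/-- `mode n` is an eigenfunction for the eigenvalue `n`, tested against a test function. -/
theorem IsTest.integral_energy_mode {φ : ℝ × ℝ → 𝕜} (hφ : IsTest φ) {n : ℕ} (hn : 0 < n) :
    ∫ p in strip, (dx φ p * (modeDx n p : 𝕜) + xdy φ p * ((p.1 * modeDy n p : ℝ) : 𝕜)) =
      n * ∫ p in strip, φ p * (mode n p : 𝕜) := by
  have hx := hφ.integral_mul_fderiv (contDiff_modeDx n) (1, 0)
  have hy := hφ.integral_mul_fderiv (contDiff_sq_mul_modeDy n) (0, 1)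
  have i1 : Integrable (fun p => dx φ p * (modeDx n p : 𝕜)) vol :=
    hφ.memLp_dx.integrable_mul (memLp_modeDx hn)
  have i2 : Integrable (fun p => xdy φ p * ((p.1 * modeDy n p : ℝ) : 𝕜)) vol :=
    hφ.memLp_xdy.integrable_mul (memLp_mul_modeDy hn)
  rw [integral_add i1 i2]
  have e2 : ∀ p : ℝ × ℝ, xdy φ p * ((p.1 * modeDy n p : ℝ) : 𝕜) =
      fderiv ℝ φ p (0, 1) * ((p.1 ^ 2 * modeDy n p : ℝ) : 𝕜) := fun p => by
    rw [xdy, RCLike.real_smul_eq_coe_mul]; push_cast; ring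
  simp only [e2]
  simp only [dx]
  rw [hx, hy, ← neg_add, ← integral_add, ← integral_neg, ← integral_const_mul]
  · congr 1
    funext p
    -- The potential terms cancel: `(n² x² - n) - n² x² = -n`.
    rw [fderiv_modeDx, fderiv_sq_mul_modeDy]
    push_cast
    ring
  · exact (((hφ.continuous.mul (RCLike.continuous_ofReal.comp
      (((contDiff_modeDx n).continuous_fderiv (by simp)).clm_apply
        continuous_const))).integrable_of_hasCompactSupport hφ.compact.mul_right).restrict)
  · exact (((hφ.continuous.mul (RCLike.continuous_ofReal.comp
      (((contDiff_sq_mul_modeDy n).continuous_fderiv (by simp)).clm_apply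
        continuous_const))).integrable_of_hasCompactSupport hφ.compact.mul_right).restrict)

/-- Both sides are continuous on `L² × L² × L²`, so the identity passes from test functions to their
closure; this is where the Dirichlet condition is used. -/
theorem energy_mode_of_mem_VGraph {w : L2 𝕜 × L2 𝕜 × L2 𝕜} (hw : w ∈ VGraph 𝕜) {n : ℕ}
    (hn : 0 < n) :
    pairing _ (memLp_modeDx hn) w.2.1 + pairing _ (memLp_mul_modeDy hn) w.2.2 =
      n * pairing _ (memLp_mode hn) w.1 := by
  refine closure_minimal (t := {w : L2 𝕜 × L2 𝕜 × L2 𝕜 |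
    pairing _ (memLp_modeDx hn) w.2.1 + pairing _ (memLp_mul_modeDy hn) w.2.2 =
      n * pairing _ (memLp_mode hn) w.1}) ?_ (isClosed_eq (by fun_prop) (by fun_prop)) hw
  rintro w ⟨φ, hφ, h1, h2, h3⟩
  simp only [Set.mem_ofPred_eq, pairing_apply]
  rw [← integral_add (integrable_mul_of_memLp _ (memLp_modeDx hn))
    (integrable_mul_of_memLp _ (memLp_mul_modeDy hn)), integral_congr_ae
    (f := fun p => w.1 p * (mode n p : 𝕜)) (g := fun p => φ p * (mode n p : 𝕜))
    (h1.mono fun p hp => by simp only [hp]), ← hφ.integral_energy_mode hn]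
  refine integral_congr_ae ?_
  filter_upwards [h2, h3] with p hp2 hp3
  rw [hp2, hp3]

end Eigen

end Modes

/-! ### Approximation of the eigenfunctions by test functions -/

section Cutoff

open scoped ContDiff Topology
open Filter

/-- A smooth function equal to `0` near `0` and to the identity away from `0`. -/
def softCut (s : ℝ) : ℝ := s * Real.smoothTransition (s ^ 2 - 1)

theorem contDiff_softCut : ContDiff ℝ ∞ softCut :=
  contDiff_id.mul (Real.smoothTransition.contDiff.comp ((contDiff_id.pow 2).sub contDiff_const))

theorem softCut_of_abs_le {s : ℝ} (hs : |s| ≤ 1) : softCut s = 0 := by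
  rw [softCut, Real.smoothTransition.zero_of_nonpos, mul_zero]
  have := (sq_le_one_iff_abs_le_one s).2 hs
  linarith

theorem softCut_of_two_le_abs {s : ℝ} (hs : 2 ≤ |s|) : softCut s = s := by
  rw [softCut, Real.smoothTransition.one_of_one_le, mul_one]
  rw [← sq_abs]; nlinarith

theorem deriv_softCut_of_two_lt_abs {s : ℝ} (hs : 2 < |s|) : deriv softCut s = 1 := by
  have h : softCut =ᶠ[𝓝 s] id := by
    filter_upwards [continuous_abs.continuousAt.eventually_const_lt hs] with t ht
    exact softCut_of_two_le_abs ht.le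
  rw [h.deriv_eq, deriv_id]

theorem continuous_deriv_softCut : Continuous (deriv softCut) :=
  contDiff_softCut.continuous_deriv (by simp)

theorem exists_abs_deriv_softCut_le : ∃ C, ∀ s, |deriv softCut s| ≤ C := by
  obtain ⟨C, hC⟩ := (isCompact_Icc (a := (-2 : ℝ)) (b := 2)).exists_bound_of_continuousOn
    continuous_deriv_softCut.continuousOn
  refine ⟨max C 1, fun s => ?_⟩
  rcases le_or_gt |s| 2 with h | h
  · exact (hC s (abs_le.1 h)).trans (le_max_left _ _)
  · rw [deriv_softCut_of_two_lt_abs h, abs_one]; exact le_max_right _ _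

/-- A compactly supported approximation of `mode n` in the strip. -/
def modeCut (n k : ℕ) : ℝ × ℝ → ℝ :=
  strip.indicator fun p => softCut ((k + 1) * mode n p) / (k + 1)

theorem mode_eq_zero_of_mem_frontier (n : ℕ) {p : ℝ × ℝ} (hp : p.2 = 0 ∨ p.2 = Real.pi) :
    mode n p = 0 := by
  rcases hp with hp | hp <;> simp [mode, hp, Real.sin_nat_mul_pi]

theorem modeCut_eventuallyEq_of_mem (n k : ℕ) {p : ℝ × ℝ} (hp : p ∈ strip) :
    modeCut n k =ᶠ[𝓝 p] fun p => softCut ((k + 1) * mode n p) / (k + 1) := by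
  filter_upwards [isOpen_strip.mem_nhds hp] with q hq
  exact Set.indicator_of_mem hq _

/-- On the edges of the strip `mode n` vanishes, so nearby it lies below the threshold `1 / (k +
1)`. -/
theorem modeCut_eventuallyEq_zero (n k : ℕ) {p : ℝ × ℝ} (hp : p ∉ strip) :
    modeCut n k =ᶠ[𝓝 p] 0 := by
  by_cases hb : p.2 = 0 ∨ p.2 = Real.pi
  · have h0 : ContinuousAt (fun q => |(k + 1) * mode n q|) p := by
      have := continuous_mode n
      fun_prop
    have h1 : |(k + 1) * mode n p| < 1 := by simp [mode_eq_zero_of_mem_frontier n hb]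
    filter_upwards [h0.eventually_lt_const h1] with q hq
    by_cases hqs : q ∈ strip
    · simp [modeCut, Set.indicator_of_mem hqs, softCut_of_abs_le hq.le]
    · simp [modeCut, Set.indicator_of_notMem hqs]
  · have h1 : p.2 ∈ (Set.Icc 0 Real.pi)ᶜ := by
      intro h
      push Not at hb
      exact hp ⟨lt_of_le_of_ne h.1 (Ne.symm hb.1), lt_of_le_of_ne h.2 hb.2⟩
    filter_upwards [continuous_snd.continuousAt.preimage_mem_nhds
      (isClosed_Icc.isOpen_compl.mem_nhds h1)] with q hq
    have hqs : q ∉ strip := fun h => hq (Set.Ioo_subset_Icc_self h)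
    simp [modeCut, Set.indicator_of_notMem hqs]

/-- Truncating by height instead of position works since `mode n` vanishes on the edges and decays
in `x`. The gradient is only multiplied by a bounded factor, so no extra cutoff terms arise. -/
theorem isTest_modeCut (𝕜 : Type*) [RCLike 𝕜] {n : ℕ} (hn : 0 < n) (k : ℕ) :
    IsTest fun p => (modeCut n k p : 𝕜) where
  smooth := by
    refine (RCLike.ofRealCLM (K := 𝕜)).contDiff.comp (contDiff_iff_contDiffAt.2 fun p => ?_)
    by_cases hp : p ∈ strip
    · refine ContDiffAt.congr_of_eventuallyEq ?_ (modeCut_eventuallyEq_of_mem n k hp)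
      exact ((contDiff_softCut.comp (contDiff_const.mul
        ((contDiff_mode n).of_le (by exact_mod_cast le_top)))).div_const _).contDiffAt
    · exact contDiffAt_const.congr_of_eventuallyEq (modeCut_eventuallyEq_zero n k hp)
  compact := by
    refine HasCompactSupport.of_support_subset_isCompact
      ((isCompact_Icc (a := -(2 * k + 1 : ℝ)) (b := 2 * k + 1)).prod
        (isCompact_Icc (a := 0) (b := Real.pi))) fun p hp => ?_
    have hp0 : modeCut n k p ≠ 0 := by
      intro h; simp [h] at hp
    have hps : p ∈ strip := by
      by_contra h
      exact hp0 (modeCut_eventuallyEq_zero n k h).self_of_nhds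
    refine ⟨?_, Set.Ioo_subset_Icc_self hps⟩
    rw [Set.mem_Icc, ← abs_le]
    have h1 : 1 < |(k + 1) * mode n p| := by
      by_contra h
      refine hp0 ?_
      rw [modeCut, Set.indicator_of_mem hps, softCut_of_abs_le (not_lt.1 h), zero_div]
    rw [mode, abs_mul, abs_mul, abs_of_pos (by positivity : (0 : ℝ) < k + 1), Real.abs_exp] at h1
    have h2 : 1 < (k + 1) * Real.exp (-(n * p.1 ^ 2 / 2)) := by
      refine h1.trans_le ?_
      gcongr
      exact mul_le_of_le_one_right (Real.exp_pos _).le (Real.abs_sin_le_one _)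
    rw [Real.exp_neg, ← div_eq_mul_inv, one_lt_div (Real.exp_pos _)] at h2
    -- With `e^{n x²/2} < k + 1` this gives `n x²/2 < k`.
    have h3 := Real.add_one_le_exp (n * p.1 ^ 2 / 2)
    have h4 : (1 : ℝ) ≤ n := by exact_mod_cast hn
    have h5 : p.1 ^ 2 ≤ 2 * k := by nlinarith [sq_nonneg p.1]
    refine abs_le_of_sq_le_sq (by nlinarith) (by positivity)
  support := by
    intro p hp
    by_contra h
    refine notMem_tsupport_iff_eventuallyEq.2 ?_ hp
    filter_upwards [modeCut_eventuallyEq_zero n k h] with q hq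
    simp [hq]

theorem fderiv_modeCut (𝕜 : Type*) [RCLike 𝕜] (n k : ℕ) {p : ℝ × ℝ} (hp : p ∈ strip) (v : ℝ × ℝ) :
    fderiv ℝ (fun p => (modeCut n k p : 𝕜)) p v =
      ((deriv softCut ((k + 1) * mode n p) * (modeDx n p * v.1 + modeDy n p * v.2) : ℝ) : 𝕜) := by
  have h1 : HasDerivAt softCut (deriv softCut ((k + 1) * mode n p)) ((k + 1) * mode n p) :=
    (contDiff_softCut.differentiable (by simp) _).hasDerivAt
  have h2 := (h1.comp_hasFDerivAt p ((hasFDerivAt_mode n p).const_mul (k + 1 : ℝ))).mul_const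
    ((k + 1 : ℝ)⁻¹)
  have h3 : HasFDerivAt (modeCut n k) _ p :=
    h2.congr_of_eventuallyEq ((modeCut_eventuallyEq_of_mem n k hp).trans
      (Eventually.of_forall fun q => by simp [div_eq_mul_inv]))
  rw [(hasFDerivAt_ofReal h3).fderiv]
  have : (k + 1 : ℝ) ≠ 0 := by positivity
  simp only [ContinuousLinearMap.comp_apply, RCLike.ofRealCLM_apply]
  congr 1
  simp
  field_simp

/-- The factor `deriv softCut ((k + 1) * mode n p)` tends to `1` only where `mode n` is nonzero. -/
theorem ae_mode_ne_zero {n : ℕ} (hn : 0 < n) : ∀ᵐ p ∂vol, mode n p ≠ 0 := by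
  rw [vol_eq_prod]
  have hs : ∀ᵐ y ∂(volume.restrict (Set.Ioo 0 Real.pi)), Real.sin (n * y) ≠ 0 := by
    refine ae_restrict_of_ae ?_
    have hc : (Set.range fun m : ℤ => (m * Real.pi / n : ℝ)).Countable := Set.countable_range _
    filter_upwards [hc.ae_notMem volume] with y hy h
    obtain ⟨m, hm⟩ := Real.sin_eq_zero_iff.1 h
    refine hy ⟨m, ?_⟩
    have : (n : ℝ) ≠ 0 := by positivity
    simp only
    field_simp
    linarith
  have h2 : ∀ᵐ p ∂((volume : Measure ℝ).prod (volume.restrict (Set.Ioo 0 Real.pi))),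
      Real.sin (n * p.2) ≠ 0 := Measure.quasiMeasurePreserving_snd.ae hs
  filter_upwards [h2] with p hp
  exact mul_ne_zero (Real.exp_pos _).ne' hp

theorem tendsto_deriv_softCut {s : ℝ} (hs : s ≠ 0) :
    Tendsto (fun k : ℕ => deriv softCut ((k + 1) * s)) atTop (𝓝 1) := by
  have h : Tendsto (fun k : ℕ => |((k : ℝ) + 1) * s|) atTop atTop := by
    simp only [abs_mul]
    refine Tendsto.atTop_mul_const (abs_pos.2 hs) (tendsto_abs_atTop_atTop.comp ?_)
    exact tendsto_atTop_add_const_right _ _ tendsto_natCast_atTop_atTop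
  refine tendsto_const_nhds.congr' ?_
  filter_upwards [h.eventually_gt_atTop 2] with k hk
  exact (deriv_softCut_of_two_lt_abs hk).symm

theorem tendsto_modeCut (n : ℕ) {p : ℝ × ℝ} (hp : p ∈ strip) :
    Tendsto (fun k => modeCut n k p) atTop (𝓝 (mode n p)) := by
  simp only [modeCut, Set.indicator_of_mem hp]
  rcases eq_or_ne (mode n p) 0 with h0 | h0
  · simp [h0, softCut]
  have h : Tendsto (fun k : ℕ => |((k : ℝ) + 1) * mode n p|) atTop atTop := by
    simp only [abs_mul]
    refine Tendsto.atTop_mul_const (abs_pos.2 h0) (tendsto_abs_atTop_atTop.comp ?_)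
    exact tendsto_atTop_add_const_right _ _ tendsto_natCast_atTop_atTop
  refine tendsto_const_nhds.congr' ?_
  filter_upwards [h.eventually_ge_atTop 2] with k hk
  rw [softCut_of_two_le_abs hk]
  field_simp

theorem abs_modeCut_le (n k : ℕ) (p : ℝ × ℝ) : |modeCut n k p| ≤ |mode n p| := by
  by_cases hp : p ∈ strip
  · rw [modeCut, Set.indicator_of_mem hp, softCut, mul_right_comm, mul_div_assoc, mul_comm, ← mul_assoc,
      abs_mul]
    rw [div_mul_cancel₀ _ (by positivity), abs_of_nonneg (Real.smoothTransition.nonneg _)]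
    exact mul_le_of_le_one_right (abs_nonneg _) (Real.smoothTransition.le_one _)
  · rw [modeCut, Set.indicator_of_notMem hp, abs_zero]; exact abs_nonneg _

section Limits

variable {𝕜 : Type*} [RCLike 𝕜]

theorem continuous_modeCut {n : ℕ} (hn : 0 < n) (k : ℕ) : Continuous (modeCut n k) :=
  (isTest_modeCut ℝ hn k).smooth.continuous

theorem tendsto_integral_mul_modeCut {α : Type*} [MeasurableSpace α] {μ : Measure α} {n : ℕ}
    (hn : 0 < n) {F : α → 𝕜} {π : α → ℝ × ℝ} (hπ : Measurable π) (hs : ∀ᵐ a ∂μ, π a ∈ strip)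
    (hF : AEStronglyMeasurable F μ) (hi : Integrable (fun a => F a * (mode n (π a) : 𝕜)) μ) :
    Tendsto (fun k => ∫ a, F a * (modeCut n k (π a) : 𝕜) ∂μ) atTop
      (𝓝 (∫ a, F a * (mode n (π a) : 𝕜) ∂μ)) := by
  refine tendsto_integral_of_dominated_convergence (fun a => ‖F a * (mode n (π a) : 𝕜)‖) (fun k => ?_)
    hi.norm (fun k => Eventually.of_forall fun a => ?_) ?_
  · exact hF.mul ((RCLike.continuous_ofReal.comp
      (continuous_modeCut hn k)).measurable.comp hπ).aestronglyMeasurable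
  · simp only [norm_mul, RCLike.norm_ofReal]
    exact mul_le_mul_of_nonneg_left (abs_modeCut_le _ _ _) (norm_nonneg _)
  · filter_upwards [hs] with a ha
    exact ((RCLike.continuous_ofReal.tendsto _).comp (tendsto_modeCut n ha)).const_mul _

theorem tendsto_integral_softCut_mul {n : ℕ} (hn : 0 < n) {G : ℝ × ℝ → 𝕜} (hi : Integrable G vol) :
    Tendsto (fun k : ℕ => ∫ p, ((deriv softCut ((k + 1) * mode n p) : ℝ) : 𝕜) * G p ∂vol) atTop
      (𝓝 (∫ p, G p ∂vol)) := by
  obtain ⟨C, hC⟩ := exists_abs_deriv_softCut_le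
  refine tendsto_integral_of_dominated_convergence (fun p => C * ‖G p‖) (fun k => ?_)
    (hi.norm.const_mul C) (fun k => Eventually.of_forall fun p => ?_) ?_
  · refine Continuous.aestronglyMeasurable ?_ |>.mul hi.1
    exact RCLike.continuous_ofReal.comp (continuous_deriv_softCut.comp
      (continuous_const.mul (continuous_mode n)))
  · rw [norm_mul, RCLike.norm_ofReal]
    gcongr
    exact hC _
  · filter_upwards [ae_mode_ne_zero hn] with p hp
    simpa using (((RCLike.continuous_ofReal (K := 𝕜)).tendsto _).comp
      (tendsto_deriv_softCut hp)).mul_const (G p)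

theorem tendsto_pairing_dx_modeCut {n : ℕ} (hn : 0 < n) (F : L2 𝕜) :
    Tendsto (fun k => pairing _ (isTest_modeCut 𝕜 hn k).memLp_dx F) atTop
      (𝓝 (pairing _ (memLp_modeDx hn) F)) := by
  simp only [pairing_apply]
  refine (tendsto_integral_softCut_mul hn (integrable_mul_of_memLp F (memLp_modeDx hn))).congr
    fun k => setIntegral_congr_fun measurableSet_strip fun p hp => ?_
  simp only [dx, fderiv_modeCut 𝕜 n k hp]
  push_cast; ring

theorem tendsto_pairing_xdy_modeCut {n : ℕ} (hn : 0 < n) (F : L2 𝕜) :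
    Tendsto (fun k => pairing _ (isTest_modeCut 𝕜 hn k).memLp_xdy F) atTop
      (𝓝 (pairing _ (memLp_mul_modeDy hn) F)) := by
  simp only [pairing_apply]
  refine (tendsto_integral_softCut_mul hn (integrable_mul_of_memLp F (memLp_mul_modeDy hn))).congr
    fun k => setIntegral_congr_fun measurableSet_strip fun p hp => ?_
  simp only [xdy, fderiv_modeCut 𝕜 n k hp, RCLike.real_smul_eq_coe_mul]
  push_cast; ring

end Limits

end Cutoff

/-! ### The weak formulation tested against eigenfunctions -/

section WeakFormulation

open scoped Topology
open Filter

/-- Lebesgue measure on `(0, t] × Ω`. -/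
abbrev timeVol (t : ℝ) : Measure (ℝ × ℝ × ℝ) := (volume.restrict (Set.Ioc 0 t)).prod vol

theorem timeVol_eq_restrict (t : ℝ) :
    timeVol t = (volume : Measure (ℝ × ℝ × ℝ)).restrict (Set.Ioc 0 t ×ˢ strip) := by
  rw [timeVol, vol, Measure.prod_restrict, Measure.volume_eq_prod ℝ (ℝ × ℝ)]

theorem timeVol_mono {s t : ℝ} (h : s ≤ t) : timeVol s ≤ timeVol t := by
  rw [timeVol_eq_restrict, timeVol_eq_restrict]
  exact Measure.restrict_mono (Set.prod_mono (Set.Ioc_subset_Ioc_right h) subset_rfl) le_rfl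

theorem restrict_Ioo_prod_strip (T : ℝ) :
    (volume : Measure (ℝ × ℝ × ℝ)).restrict (Set.Ioo 0 T ×ˢ strip) = timeVol T := by
  rw [timeVol, Measure.volume_eq_prod ℝ (ℝ × ℝ), ← Measure.prod_restrict,
    Measure.restrict_congr_set Ioo_ae_eq_Ioc]

section

variable {𝕜 : Type*} [RCLike 𝕜]

/-- The control multiplied by the indicator function of the control domain. -/
def localizedControl (ω : Set (ℝ × ℝ)) (u : ℝ → ℝ × ℝ → 𝕜) (z : ℝ × ℝ × ℝ) : 𝕜 :=
  ω.indicator (u z.1) z.2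

theorem memLp_localizedControl {T : ℝ} {ω : Set (ℝ × ℝ)} (hω : MeasurableSet ω)
    {u : ℝ → ℝ × ℝ → 𝕜}
    (hu : MemLp (Function.uncurry u) 2 (volume.restrict (Set.Ioo 0 T ×ˢ strip))) :
    MemLp (localizedControl ω u) 2 (timeVol T) := by
  rw [restrict_Ioo_prod_strip] at hu
  refine (hu.indicator (measurable_snd hω)).ae_eq (Eventually.of_forall fun z => ?_)
  simp only [localizedControl, Set.indicator, Set.mem_preimage]
  rfl

theorem integrable_mul_snd {T : ℝ} {W : ℝ × ℝ × ℝ → 𝕜} (hW : MemLp W 2 (timeVol T))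
    {g : ℝ × ℝ → 𝕜} (hg : MemLp g 2 vol) {t : ℝ} (ht : t ≤ T) :
    Integrable (fun z => W z * g z.2) (timeVol t) :=
  (hW.integrable_mul (hg.comp_snd (volume.restrict (Set.Ioc 0 T)))).mono_measure (timeVol_mono ht)

theorem intervalIntegral_integral_strip {T : ℝ} {W : ℝ × ℝ × ℝ → 𝕜} (hW : MemLp W 2 (timeVol T))
    {g : ℝ × ℝ → 𝕜} (hg : MemLp g 2 vol) {t : ℝ} (ht : t ∈ Set.Icc 0 T) :
    ∫ s in (0 : ℝ)..t, ∫ p in strip, W (s, p) * g p = ∫ z, W z * g z.2 ∂timeVol t := by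
  rw [intervalIntegral.integral_of_le ht.1, integral_prod _ (integrable_mul_snd hW hg ht.2)]

theorem intervalIntegrable_of_memLp_Ioo {E : Type*} [NormedAddCommGroup E] {T t : ℝ}
    {P : ℝ → E} (hP : MemLp P 2 (volume.restrict (Set.Ioo 0 T))) (ht : t ∈ Set.Icc 0 T) :
    IntervalIntegrable P volume 0 t := by
  rw [intervalIntegrable_iff_integrableOn_Ioo_of_le ht.1]
  exact (hP.integrable (by norm_num)).mono_measure
    (Measure.restrict_mono (Set.Ioo_subset_Ioo_right ht.2) le_rfl)

theorem intervalIntegrable_clm {𝕂 E F : Type*} [RCLike 𝕂] [NormedAddCommGroup E] [NormedSpace 𝕂 E]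
    [NormedAddCommGroup F] [NormedSpace 𝕂 F] (L : E →L[𝕂] F) {g : ℝ → E} {a b : ℝ}
    (hg : IntervalIntegrable g volume a b) : IntervalIntegrable (fun s => L (g s)) volume a b :=
  ⟨L.integrable_comp hg.1, L.integrable_comp hg.2⟩

/-- With the time integrals of `P` and `Q` taken in `L²`, the later limit in the test function
involves fixed elements of `L²`, and no domination in time is needed for the gradient terms. -/
theorem weak_formulation_pairing {T : ℝ} {ω : Set (ℝ × ℝ)} {f₀ : L2 𝕜} {u : ℝ → ℝ × ℝ → 𝕜}
    (hu : MemLp (localizedControl ω u) 2 (timeVol T)) {f P Q : ℝ → L2 𝕜}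
    (hP : MemLp P 2 (volume.restrict (Set.Ioo 0 T)))
    (hQ : MemLp Q 2 (volume.restrict (Set.Ioo 0 T))) {φ : ℝ × ℝ → 𝕜} (hφ : IsTest φ) {t : ℝ}
    (ht : t ∈ Set.Icc 0 T)
    (h : (∫ p in strip, f t p * φ p) - (∫ p in strip, f₀ p * φ p) +
        (∫ s in (0 : ℝ)..t, ∫ p in strip, (P s p * dx φ p + Q s p * xdy φ p)) =
      ∫ s in (0 : ℝ)..t, ∫ p in strip, ω.indicator (u s) p * φ p) :
    (∫ p, f t p * φ p ∂vol) - (∫ p, f₀ p * φ p ∂vol) +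
      (pairing _ hφ.memLp_dx (∫ s in (0 : ℝ)..t, P s) +
        pairing _ hφ.memLp_xdy (∫ s in (0 : ℝ)..t, Q s)) =
      ∫ z, localizedControl ω u z * φ z.2 ∂timeVol t := by
  have hPi := intervalIntegrable_of_memLp_Ioo hP ht
  have hQi := intervalIntegrable_of_memLp_Ioo hQ ht
  rw [← intervalIntegral_integral_strip hu hφ.memLp ht]
  refine Eq.trans ?_ h
  congr 1
  rw [← ContinuousLinearMap.intervalIntegral_comp_comm _ hPi,
    ← ContinuousLinearMap.intervalIntegral_comp_comm _ hQi,
    ← intervalIntegral.integral_add (intervalIntegrable_clm _ hPi)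
      (intervalIntegrable_clm _ hQi)]
  refine intervalIntegral.integral_congr fun s _ => ?_
  simp only [pairing_apply]
  rw [← integral_add (integrable_mul_of_memLp _ hφ.memLp_dx)
    (integrable_mul_of_memLp _ hφ.memLp_xdy)]

/-- The weak formulation tested against `mode n`. -/
theorem IsWeakSolution.pairing_mode {T : ℝ} {ω : Set (ℝ × ℝ)} {f₀ : L2 𝕜} {u : ℝ → ℝ × ℝ → 𝕜}
    {f : ℝ → L2 𝕜} (h : IsWeakSolution T ω f₀ u f)
    (hu : MemLp (localizedControl ω u) 2 (timeVol T)) {n : ℕ} (hn : 0 < n) {t : ℝ}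
    (ht : t ∈ Set.Icc 0 T) :
    pairing _ (memLp_mode hn) (f t) - pairing _ (memLp_mode hn) f₀ +
      n * ∫ s in (0 : ℝ)..t, pairing _ (memLp_mode hn) (f s) =
      ∫ s in (0 : ℝ)..t, ∫ p in strip, localizedControl ω u (s, p) * (mode n p : 𝕜) := by
  obtain ⟨-, -, P, Q, hP, hQ, hV, hw⟩ := h
  have hPi := intervalIntegrable_of_memLp_Ioo hP ht
  have hQi := intervalIntegrable_of_memLp_Ioo hQ ht
  have hs : ∀ᵐ p ∂vol, p ∈ strip := ae_restrict_mem measurableSet_strip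
  have hs' : ∀ᵐ z ∂timeVol t, z.2 ∈ strip := Measure.quasiMeasurePreserving_snd.ae hs
  have lim1 : ∀ F : L2 𝕜, Tendsto (fun k => ∫ p, F p * (modeCut n k p : 𝕜) ∂vol) atTop
      (𝓝 (pairing _ (memLp_mode hn) F)) := fun F => by
    rw [pairing_apply]
    exact tendsto_integral_mul_modeCut hn measurable_id hs (Lp.aestronglyMeasurable F)
      (integrable_mul_of_memLp F (memLp_mode hn))
  have lim2 : Tendsto (fun k => ∫ z, localizedControl ω u z * (modeCut n k z.2 : 𝕜) ∂timeVol t) atTop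
      (𝓝 (∫ z, localizedControl ω u z * (mode n z.2 : 𝕜) ∂timeVol t)) :=
    tendsto_integral_mul_modeCut hn measurable_snd hs' (hu.1.mono_measure (timeVol_mono ht.2))
      (integrable_mul_snd hu (memLp_mode hn) ht.2)
  have lim3 := (((lim1 (f t)).sub (lim1 f₀)).add
    ((tendsto_pairing_dx_modeCut hn (∫ s in (0 : ℝ)..t, P s)).add
      (tendsto_pairing_xdy_modeCut hn (∫ s in (0 : ℝ)..t, Q s))))
  have key := tendsto_nhds_unique (lim3.congr fun k =>
    weak_formulation_pairing hu hP hQ (isTest_modeCut 𝕜 hn k) ht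
      (hw _ (isTest_modeCut 𝕜 hn k) t ht)) lim2
  rw [intervalIntegral_integral_strip hu (memLp_mode hn) ht, ← key]
  congr 1
  rw [← ContinuousLinearMap.intervalIntegral_comp_comm _ hPi,
    ← ContinuousLinearMap.intervalIntegral_comp_comm _ hQi,
    ← intervalIntegral.integral_add (intervalIntegrable_clm _ hPi)
      (intervalIntegrable_clm _ hQi),
    ← intervalIntegral.integral_const_mul, intervalIntegral.integral_of_le ht.1,
    intervalIntegral.integral_of_le ht.1]
  refine integral_congr_ae ?_
  have hV' : ∀ᵐ s ∂(volume.restrict (Set.Ioc 0 t)), (f s, P s, Q s) ∈ VGraph 𝕜 := by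
    rw [Measure.restrict_congr_set Ioo_ae_eq_Ioc] at hV
    exact ae_restrict_of_ae_restrict_of_subset (Set.Ioc_subset_Ioc_right ht.2) hV
  filter_upwards [hV'] with s hsV
  exact (energy_mode_of_mem_VGraph hsV hn).symm

theorem integrable_exp_mul_mode {T : ℝ} {g : ℝ × ℝ × ℝ → ℝ} (hg : MemLp g 2 (timeVol T)) {n : ℕ}
    (hn : 0 < n) :
    Integrable (fun z => Real.exp (n * z.1) * (g z * mode n z.2)) (timeVol T) := by
  have h1 : Integrable (fun z => g z * mode n z.2) (timeVol T) :=
    integrable_mul_snd hg (memLp_mode (𝕜 := ℝ) hn) le_rfl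
  refine h1.bdd_mul (f := fun z : ℝ × ℝ × ℝ => Real.exp (n * z.1)) (c := Real.exp (n * T))
    (by fun_prop) ?_
  rw [timeVol_eq_restrict]
  filter_upwards [ae_restrict_mem (measurableSet_Ioc.prod measurableSet_strip)] with z hz
  rw [Real.norm_eq_abs, Real.abs_exp]
  gcongr
  exact hz.1.2

/-- The moment problem solved by a control which steers the solution to zero. -/
theorem IsWeakSolution.re_pairing_mode {T : ℝ} (hT : 0 ≤ T) {ω : Set (ℝ × ℝ)} {f₀ : L2 𝕜}
    {u : ℝ → ℝ × ℝ → 𝕜} {f : ℝ → L2 𝕜} (h : IsWeakSolution T ω f₀ u f) (hfT : f T = 0)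
    (hu : MemLp (localizedControl ω u) 2 (timeVol T)) {n : ℕ} (hn : 0 < n) :
    RCLike.re (pairing _ (memLp_mode hn) f₀) =
      - ∫ z, Real.exp (n * z.1) * (RCLike.re (localizedControl ω u z) * mode n z.2) ∂timeVol T := by
  set ℓ := pairing (𝕜 := 𝕜) _ (memLp_mode hn) with hℓ
  set W := localizedControl ω u with hW
  have hWi : Integrable (fun z => W z * (mode n z.2 : 𝕜)) (timeVol T) :=
    integrable_mul_snd hu (memLp_mode hn) le_rfl
  have hbi : IntervalIntegrable (fun s => ∫ p in strip, W (s, p) * (mode n p : 𝕜)) volume 0 T := by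
    rw [intervalIntegrable_iff_integrableOn_Ioc_of_le hT]
    exact hWi.integral_prod_left
  have hfc : ContinuousOn f (Set.uIcc 0 T) := by rw [Set.uIcc_of_le hT]; exact h.1
  have hmi : IntervalIntegrable (fun s => ℓ (f s)) volume 0 T :=
    (ℓ.continuous.comp_continuousOn hfc).intervalIntegrable
  have hre : ∀ {g : ℝ → 𝕜} {t : ℝ}, t ∈ Set.Icc 0 T → IntervalIntegrable g volume 0 T →
      RCLike.re (∫ s in (0 : ℝ)..t, g s) = ∫ s in (0 : ℝ)..t, RCLike.re (g s) := fun ht hg =>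
    ((RCLike.reCLM (K := 𝕜)).intervalIntegral_comp_comm (hg.mono_set (by
      rw [Set.uIcc_of_le hT, Set.uIcc_of_le ht.1]
      exact Set.Icc_subset_Icc_right ht.2))).symm
  have hode := eq_neg_integral_exp_mul (c := n) (m := fun t => RCLike.re (ℓ (f t)))
    (b := fun s => RCLike.re (∫ p in strip, W (s, p) * (mode n p : 𝕜))) hT
    (intervalIntegrable_clm (RCLike.reCLM (K := 𝕜)) hmi)
    (intervalIntegrable_clm (RCLike.reCLM (K := 𝕜)) hbi)
    (fun t ht => by
      have := congrArg RCLike.re (h.pairing_mode hu hn ht)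
      rw [← hre ht hmi, ← hre ht hbi, ← this, h.2.1]
      simp [hℓ, RCLike.mul_re])
    (by simp [hfT])
  simp only [h.2.1] at hode
  rw [hode, intervalIntegral.integral_of_le hT]
  congr 1
  have hexp := integrable_exp_mul_mode hu.re hn
  rw [integral_prod _ hexp]
  refine integral_congr_ae ?_
  filter_upwards [hWi.prod_right_ae] with s hsi
  simp only [integral_const_mul]
  congr 1
  rw [← integral_re hsi]
  simp [RCLike.mul_re]

end

end WeakFormulation

/-! ### Orthogonality and initial data with prescribed moments -/

section MomentProblem

open scoped Topology
open Filter

theorem integral_cos_int_mul {c : ℤ} (hc : c ≠ 0) :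
    ∫ y in (0 : ℝ)..Real.pi, Real.cos (c * y) = 0 := by
  rw [intervalIntegral.integral_comp_mul_left _ (Int.cast_ne_zero.2 hc), integral_cos]
  simp [Real.sin_int_mul_pi]

theorem integral_sin_mul_sin {n m : ℕ} (hn : 0 < n) :
    ∫ y in (0 : ℝ)..Real.pi, Real.sin (n * y) * Real.sin (m * y) =
      if n = m then Real.pi / 2 else 0 := by
  have h : ∀ y : ℝ, Real.sin (n * y) * Real.sin (m * y) =
      (Real.cos (((n - m : ℤ) : ℝ) * y) - Real.cos (((n + m : ℤ) : ℝ) * y)) / 2 := fun y => by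
    push_cast
    rw [sub_mul, add_mul, Real.cos_sub, Real.cos_add]
    ring
  simp only [h]
  rw [intervalIntegral.integral_div, intervalIntegral.integral_sub
    (Continuous.intervalIntegrable (by fun_prop) _ _)
    (Continuous.intervalIntegrable (by fun_prop) _ _), integral_cos_int_mul (c := n + m) (by omega)]
  split_ifs with hnm
  · simp [hnm]
  · rw [integral_cos_int_mul (c := n - m) (by omega)]
    simp

/-- The squared norm of `mode n` in the strip. -/
def modeNormSq (n : ℕ) : ℝ := √(Real.pi / n) * (Real.pi / 2)

theorem modeNormSq_pos {n : ℕ} (hn : 0 < n) : 0 < modeNormSq n := by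
  unfold modeNormSq; positivity

theorem integral_mode_mul_mode {n m : ℕ} (hn : 0 < n) :
    ∫ p, mode n p * mode m p ∂vol = if n = m then modeNormSq n else 0 := by
  have h : ∀ p : ℝ × ℝ, mode n p * mode m p =
      Real.exp (-((n + m) / 2 : ℝ) * p.1 ^ 2) * (Real.sin (n * p.2) * Real.sin (m * p.2)) :=
    fun p => by
      have : Real.exp (-((n + m) / 2 : ℝ) * p.1 ^ 2) =
        Real.exp (-(n * p.1 ^ 2 / 2)) * Real.exp (-(m * p.1 ^ 2 / 2)) := by
        rw [← Real.exp_add]; congr 1; ring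
      rw [this, mode, mode]; ring
  simp only [h]
  rw [vol_eq_prod, integral_prod_mul (fun x : ℝ => Real.exp (-((n + m) / 2 : ℝ) * x ^ 2))
    (fun y : ℝ => Real.sin (n * y) * Real.sin (m * y)), integral_gaussian,
    ← integral_Ioc_eq_integral_Ioo, ← intervalIntegral.integral_of_le Real.pi_pos.le,
    integral_sin_mul_sin hn]
  split_ifs with hnm
  · rw [← hnm, modeNormSq]; congr 3; ring
  · simp

variable {𝕜 : Type*} [RCLike 𝕜]

theorem pairing_mode_toLp_mode {n m : ℕ} (hn : 0 < n) (hm : 0 < m) :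
    pairing _ (memLp_mode (𝕜 := 𝕜) hm) (memLp_mode (𝕜 := 𝕜) hn).toLp =
      ((if n = m then modeNormSq n else 0 : ℝ) : 𝕜) := by
  rw [pairing_apply, ← integral_mode_mul_mode hn, ← integral_ofReal]
  refine integral_congr_ae ?_
  filter_upwards [(memLp_mode (𝕜 := 𝕜) hn).coeFn_toLp] with p hp
  rw [hp]
  push_cast
  rfl

theorem norm_toLp_mode_sq {n : ℕ} (hn : 0 < n) :
    ‖(memLp_mode (𝕜 := 𝕜) hn).toLp‖ ^ 2 = modeNormSq n := by
  have h1 := inner_self_eq_norm_sq_to_K (𝕜 := 𝕜) (memLp_mode (𝕜 := 𝕜) hn).toLp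
  have h2 : inner 𝕜 (memLp_mode (𝕜 := 𝕜) hn).toLp (memLp_mode (𝕜 := 𝕜) hn).toLp =
      ((modeNormSq n : ℝ) : 𝕜) := by
    have h3 := pairing_mode_toLp_mode (𝕜 := 𝕜) hn hn
    rw [if_pos rfl, pairing_apply] at h3
    rw [← h3, L2.inner_def]
    refine integral_congr_ae ?_
    filter_upwards [(memLp_mode (𝕜 := 𝕜) hn).coeFn_toLp] with p hp
    rw [hp]
    simp only [RCLike.inner_apply, RCLike.conj_ofReal]
  rw [h2] at h1
  exact_mod_cast h1.symm

/-- Any polynomial bound suffices: the geometric decay of the moments absorbs it. -/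
theorem inv_modeNormSq_le {n : ℕ} (hn : 0 < n) : (modeNormSq n)⁻¹ ≤ n := by
  have h1 : (1 : ℝ) ≤ n := by exact_mod_cast hn
  have h2 := Real.pi_gt_three
  have h3 : 1 / (n : ℝ) ≤ √(Real.pi / n) := by
    refine Real.le_sqrt_of_sq_le ?_
    rw [div_pow, one_pow]
    gcongr
    · linarith
    · nlinarith
  refine inv_le_of_inv_le₀ (by positivity) ?_
  rw [modeNormSq, ← one_div]
  nlinarith [Real.sqrt_nonneg (Real.pi / n)]

theorem modeNormSq_le {n : ℕ} (hn : 0 < n) : modeNormSq n ≤ modeNormSq 1 := by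
  have h1 : (1 : ℝ) ≤ n := by exact_mod_cast hn
  unfold modeNormSq
  gcongr
  exact_mod_cast hn

/-- The moment problem for the modes is solvable for geometrically decaying moments. -/
theorem exists_pairing_mode_eq {β : ℕ → ℝ} {r : ℝ} (hr0 : 0 ≤ r) (hr : r < 1)
    (hβ : ∀ n, |β n| ≤ r ^ n) :
    ∃ f₀ : L2 𝕜, ∀ n (hn : 0 < n), pairing _ (memLp_mode hn) f₀ = (β n : 𝕜) := by
  set Φ : ℕ → L2 𝕜 := fun k => (memLp_mode (𝕜 := 𝕜) k.succ_pos).toLp with hΦ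
  set c : ℕ → ℝ := fun k => β (k + 1) / modeNormSq (k + 1) with hc
  have hs : Summable fun k => ((c k : ℝ) : 𝕜) • Φ k := by
    have hg : Summable fun k : ℕ => ((k + 1 : ℕ) : ℝ) ^ 1 * r ^ (k + 1) :=
      (summable_nat_add_iff (f := fun k : ℕ => (k : ℝ) ^ 1 * r ^ k) 1).2 (summable_pow_mul_geometric_of_norm_lt_one 1
        (by rwa [Real.norm_of_nonneg hr0]))
    refine Summable.of_norm_bounded (hg.mul_right √(modeNormSq 1)) fun k => ?_
    have h1 : ‖Φ k‖ ≤ √(modeNormSq 1) := by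
      refine Real.le_sqrt_of_sq_le ?_
      rw [hΦ, norm_toLp_mode_sq k.succ_pos]
      exact modeNormSq_le k.succ_pos
    have h2 : |c k| ≤ ((k + 1 : ℕ) : ℝ) ^ 1 * r ^ (k + 1) := by
      simp only [hc]
      rw [div_eq_inv_mul, abs_mul, abs_of_pos (inv_pos.2 (modeNormSq_pos k.succ_pos)), pow_one]
      exact mul_le_mul (inv_modeNormSq_le k.succ_pos) (hβ _) (abs_nonneg _) (by positivity)
    rw [norm_smul, RCLike.norm_ofReal]
    exact mul_le_mul h2 h1 (norm_nonneg _) (by positivity)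
  refine ⟨∑' k, ((c k : ℝ) : 𝕜) • Φ k, fun n hn => ?_⟩
  obtain ⟨m, rfl⟩ : ∃ m, n = m + 1 := ⟨n - 1, by omega⟩
  have h1 := hs.hasSum.mapL (pairing _ (memLp_mode (𝕜 := 𝕜) hn))
  refine h1.unique ?_
  convert hasSum_single m ?_ using 1
  · simp only [hΦ, hc]
    rw [map_smul, pairing_mode_toLp_mode m.succ_pos hn, if_pos rfl, smul_eq_mul, ← RCLike.ofReal_mul,
      div_mul_cancel₀ _ (modeNormSq_pos hn).ne']
  · intro k hk
    rw [map_smul, hΦ, pairing_mode_toLp_mode k.succ_pos hn, if_neg (by omega)]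
    simp

end MomentProblem

/-! ### From moments to polynomial estimates -/

section MomentEstimate

open scoped Topology
open Filter

/-- Each `e^{-nτ} mode n` is `(z^n - z̄^n) / 2i` with `z = exp (-τ - x²/2 + i y)`. Modes start at
`1`, so `q_i` goes with `z^{i+1}`, whence the factor `z` before `q(z)`. -/
theorem sum_mul_exp_mul_mode (q : Polynomial ℂ) (τ : ℝ) (p : ℝ × ℝ) :
    ∑ i ∈ Finset.range (q.natDegree + 1),
        q.coeff i * ((Real.exp (-((i + 1 : ℕ) * τ)) * mode (i + 1) p : ℝ) : ℂ) =
      (Complex.exp ((-τ - p.1 ^ 2 / 2 : ℝ) + (p.2 : ℝ) * Complex.I) *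
          q.eval (Complex.exp ((-τ - p.1 ^ 2 / 2 : ℝ) + (p.2 : ℝ) * Complex.I)) -
        Complex.exp ((-τ - p.1 ^ 2 / 2 : ℝ) + ((-p.2 : ℝ) : ℂ) * Complex.I) *
          q.eval (Complex.exp ((-τ - p.1 ^ 2 / 2 : ℝ) + ((-p.2 : ℝ) : ℂ) * Complex.I))) /
        (2 * Complex.I) := by
  rw [Polynomial.eval_eq_sum_range, Polynomial.eval_eq_sum_range, Finset.mul_sum, Finset.mul_sum,
    ← Finset.sum_sub_distrib, Finset.sum_div]
  refine Finset.sum_congr rfl fun i _ => ?_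
  have h : ∀ z : ℂ, Complex.exp z * (q.coeff i * Complex.exp z ^ i) =
      q.coeff i * Complex.exp ((i + 1 : ℕ) * z) := fun z => by
    rw [Complex.exp_nat_mul, pow_succ]; ring
  rw [h, h, ← mul_sub, mul_div_assoc]
  congr 1
  have e : ∀ y : ℝ, Complex.exp ((i + 1 : ℕ) * ((-τ - p.1 ^ 2 / 2 : ℝ) + (y : ℂ) * Complex.I)) =
      (Real.exp (-((i + 1 : ℕ) * τ)) * Real.exp (-((i + 1 : ℕ) * p.1 ^ 2 / 2)) : ℝ) *
        Complex.exp ((((i + 1 : ℕ) * y : ℝ) : ℂ) * Complex.I) := fun y => by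
    rw [← Real.exp_add, Complex.ofReal_exp, ← Complex.exp_add]
    congr 1
    push_cast
    ring
  rw [e, e, ← mul_sub, mul_div_assoc, mode, ← mul_assoc, Complex.ofReal_mul, Complex.ofReal_sin,
    Complex.sin]
  congr 1
  rw [div_eq_div_iff two_ne_zero (by simp)]
  push_cast
  ring_nf
  simp only [Complex.I_sq]
  ring

/-- The extra factor `z` supplies the Gaussian, which makes the bound square integrable on the
unbounded strip. -/
theorem norm_sum_mul_exp_mul_mode_le {q : Polynomial ℂ} {δ τ : ℝ} (hτ : 0 ≤ τ) {p : ℝ × ℝ}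
    (hq : ∀ y, (y = p.2 ∨ y = -p.2) →
      ‖q.eval (Complex.exp ((-τ - p.1 ^ 2 / 2 : ℝ) + (y : ℝ) * Complex.I))‖ ≤ δ) :
    ‖∑ i ∈ Finset.range (q.natDegree + 1),
        q.coeff i * ((Real.exp (-((i + 1 : ℕ) * τ)) * mode (i + 1) p : ℝ) : ℂ)‖ ≤
      δ * Real.exp (-(p.1 ^ 2 / 2)) := by
  have h1 := hq _ (Or.inl rfl)
  have h2 := hq _ (Or.inr rfl)
  have hδ : 0 ≤ δ := (norm_nonneg _).trans h1
  have he : ∀ y : ℝ, ‖Complex.exp ((-τ - p.1 ^ 2 / 2 : ℝ) + (y : ℂ) * Complex.I)‖ ≤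
      Real.exp (-(p.1 ^ 2 / 2)) := fun y => by
    rw [Complex.norm_exp]
    refine Real.exp_le_exp.2 ?_
    rw [Complex.add_re, Complex.ofReal_re, Complex.re_ofReal_mul, Complex.I_re]
    linarith
  have hm : ∀ y : ℝ, ∀ Z : ℂ, ‖Z‖ ≤ δ →
      ‖Complex.exp ((-τ - p.1 ^ 2 / 2 : ℝ) + (y : ℂ) * Complex.I) * Z‖ ≤
        Real.exp (-(p.1 ^ 2 / 2)) * δ := fun y Z hZ => by
    rw [norm_mul]
    exact mul_le_mul (he y) hZ (norm_nonneg _) (Real.exp_pos _).le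
  rw [sum_mul_exp_mul_mode, norm_div, norm_mul, Complex.norm_I, mul_one]
  simp only [Complex.norm_ofNat]
  rw [div_le_iff₀ two_pos]
  refine (norm_sub_le _ _).trans ?_
  linarith [hm p.2 _ h1, hm (-p.2) _ h2]

theorem memLp_gauss : MemLp (fun p : ℝ × ℝ => Real.exp (-(p.1 ^ 2 / 2))) 2 vol := by
  refine (memLp_mul_prod (𝕜 := ℝ) (a := fun x => Real.exp (-(1 * x ^ 2 / 2))) (b := fun _ => 1)
    (by fun_prop) (integrable_gauss_sq one_pos) (by fun_prop)).ae_eq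
    (Eventually.of_forall fun p => ?_)
  simp

theorem measurableSet_controlDomain (y₀ : ℝ) {f : ℝ → ℝ} (hf : Continuous f) :
    MeasurableSet (controlDomain y₀ f) :=
  measurableSet_strip.inter (measurableSet_lt (f := fun p : ℝ × ℝ => f p.1)
    (g := fun p : ℝ × ℝ => |p.2 - y₀|) (by fun_prop) (by fun_prop))

variable {𝕜 : Type*} [RCLike 𝕜]

/-- The estimate on moments which null-controllability implies: a polynomial which is small on
the image of the control domain is small on the moment sequence of each initial datum. -/
theorem NullControllable.moment_estimate {T : ℝ} (hT : 0 ≤ T) {ω : Set (ℝ × ℝ)}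
    (hω : MeasurableSet ω) (h : NullControllable 𝕜 T ω) {β : ℕ → ℝ} {r : ℝ} (hr0 : 0 ≤ r)
    (hr : r < 1) (hβ : ∀ n, |β n| ≤ r ^ n) :
    ∃ C : ℝ, ∀ (q : Polynomial ℂ) (δ : ℝ), (∀ τ, 0 ≤ τ → ∀ p ∈ ω, ∀ y, (y = p.2 ∨ y = -p.2) →
        ‖q.eval (Complex.exp ((-τ - p.1 ^ 2 / 2 : ℝ) + y * Complex.I))‖ ≤ δ) →
      ‖∑ i ∈ Finset.range (q.natDegree + 1),
        q.coeff i * ((Real.exp (-((i + 1 : ℕ) * T)) * β (i + 1) : ℝ) : ℂ)‖ ≤ C * δ := by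
  obtain ⟨f₀, hf₀⟩ := exists_pairing_mode_eq (𝕜 := 𝕜) hr0 hr hβ
  obtain ⟨u, hu, f, hf, hfT⟩ := h f₀
  have hW := memLp_localizedControl hω hu
  set W : ℝ × ℝ × ℝ → ℝ := fun z => RCLike.re (localizedControl ω u z) with hWdef
  have hWr : MemLp W 2 (timeVol T) := hW.re
  have hmom : ∀ i : ℕ, β (i + 1) =
      - ∫ z, Real.exp ((i + 1 : ℕ) * z.1) * (W z * mode (i + 1) z.2) ∂timeVol T := fun i => by
    rw [← hf.re_pairing_mode hT hfT hW i.succ_pos, hf₀ _ i.succ_pos]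
    simp
  have hgi : Integrable (fun z => |W z| * Real.exp (-(z.2.1 ^ 2 / 2))) (timeVol T) :=
    integrable_mul_snd hWr.abs memLp_gauss le_rfl
  -- The constant depends on the chosen control, hence on `β`, but not on `q` or `δ`; no uniform
  -- control cost is needed.
  refine ⟨∫ z, |W z| * Real.exp (-(z.2.1 ^ 2 / 2)) ∂timeVol T, fun q δ hq => ?_⟩
  have hsum : ∑ i ∈ Finset.range (q.natDegree + 1),
      q.coeff i * ((Real.exp (-((i + 1 : ℕ) * T)) * β (i + 1) : ℝ) : ℂ) =
      - ∫ z, ∑ i ∈ Finset.range (q.natDegree + 1), q.coeff i *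
        ((Real.exp (-((i + 1 : ℕ) * T)) *
          (Real.exp ((i + 1 : ℕ) * z.1) * (W z * mode (i + 1) z.2)) : ℝ) : ℂ) ∂timeVol T := by
    rw [integral_finsetSum _ fun i _ => (((integrable_exp_mul_mode hWr
      i.succ_pos).const_mul _).ofReal).const_mul _, ← Finset.sum_neg_distrib]
    refine Finset.sum_congr rfl fun i _ => ?_
    rw [integral_const_mul, integral_complex_ofReal, integral_const_mul, hmom]
    push_cast
    ring
  rw [hsum, norm_neg, ← integral_mul_const]
  refine norm_integral_le_of_norm_le (hgi.mul_const δ) ?_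
  have hmem : ∀ᵐ z ∂timeVol T, z ∈ Set.Ioc 0 T ×ˢ strip := by
    rw [timeVol_eq_restrict]
    exact ae_restrict_mem (measurableSet_Ioc.prod measurableSet_strip)
  filter_upwards [hmem] with z hz
  have hfac : ∑ i ∈ Finset.range (q.natDegree + 1), q.coeff i *
        ((Real.exp (-((i + 1 : ℕ) * T)) *
          (Real.exp ((i + 1 : ℕ) * z.1) * (W z * mode (i + 1) z.2)) : ℝ) : ℂ) =
      (W z : ℂ) * ∑ i ∈ Finset.range (q.natDegree + 1),
        q.coeff i * ((Real.exp (-((i + 1 : ℕ) * (T - z.1))) * mode (i + 1) z.2 : ℝ) : ℂ) := by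
    rw [Finset.mul_sum]
    refine Finset.sum_congr rfl fun i _ => ?_
    have : Real.exp (-((i + 1 : ℕ) * (T - z.1))) =
        Real.exp (-((i + 1 : ℕ) * T)) * Real.exp ((i + 1 : ℕ) * z.1) := by
      rw [← Real.exp_add]; congr 1; ring
    rw [this]
    push_cast
    ring
  rw [hfac, norm_mul, Complex.norm_real, Real.norm_eq_abs]
  by_cases hzω : z.2 ∈ ω
  · calc |W z| * _ ≤ |W z| * (δ * Real.exp (-(z.2.1 ^ 2 / 2))) := by
          gcongr
          exact norm_sum_mul_exp_mul_mode_le (sub_nonneg.2 hz.1.2)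
            (hq _ (sub_nonneg.2 hz.1.2) _ hzω)
      _ = _ := by ring
  · have : W z = 0 := by simp [hWdef, localizedControl, Set.indicator_of_notMem hzω]
    simp [this]

end MomentEstimate

end Grushin

end

/-! ### Conclusion -/

theorem theorem3 {𝕜 : Type*} [RCLike 𝕜] (y₀ : ℝ) (hy₀ : y₀ ∈ Set.Ioo 0 Real.pi)
    (f : ℝ → ℝ) (hf : Continuous f) (hpos : ∀ x, 0 < f x) (T : ℝ) (hT : 0 < T) :
    ¬ Grushin.NullControllable 𝕜 T (Grushin.controlDomain y₀ f) := by
  intro h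
  obtain ⟨w, p, hw0, hwT, hpw, hp⟩ := Grushin.exists_polynomial_small_on_control hy₀ hf hpos hT
  have hω := Grushin.measurableSet_controlDomain y₀ hf
  -- The weights `e^{-(i+1)T}` turn the moments `v^{i+1}` into `w^{i+1}`.
  set v : ℂ := w * Real.exp T with hv
  have hvn : ‖v‖ < 1 := by
    rw [hv, norm_mul, Complex.norm_real, Real.norm_eq_abs, Real.abs_exp]
    calc ‖w‖ * Real.exp T < Real.exp (-T) * Real.exp T := by gcongr
      _ = 1 := by rw [← Real.exp_add]; simp
  -- Real and imaginary parts are treated as two data, since `𝕜` may be `ℝ`.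
  obtain ⟨C₁, hC₁⟩ := h.moment_estimate hT.le hω (norm_nonneg v) hvn (β := fun n => (v ^ n).re)
    fun n => (Complex.abs_re_le_norm _).trans (norm_pow v n).le
  obtain ⟨C₂, hC₂⟩ := h.moment_estimate hT.le hω (norm_nonneg v) hvn (β := fun n => (v ^ n).im)
    fun n => (Complex.abs_im_le_norm _).trans (norm_pow v n).le
  have key : ∀ k : ℕ, ‖w‖ ≤ (C₁ + C₂) * (1 / 2) ^ k := by
    intro k
    have hk : ∀ τ, 0 ≤ τ → ∀ q ∈ Grushin.controlDomain y₀ f, ∀ y, (y = q.2 ∨ y = -q.2) →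
        ‖(p ^ k).eval (Complex.exp ((-τ - q.1 ^ 2 / 2 : ℝ) + y * Complex.I))‖ ≤ (1 / 2) ^ k := by
      intro τ hτ q hq y hy
      rw [Polynomial.eval_pow, norm_pow]
      exact pow_le_pow_left₀ (norm_nonneg _) (hp τ hτ q hq y hy) k
    have h1 := hC₁ _ _ hk
    have h2 := hC₂ _ _ hk
    set S₁ := ∑ i ∈ Finset.range ((p ^ k).natDegree + 1),
      (p ^ k).coeff i * ((Real.exp (-((i + 1 : ℕ) * T)) * (v ^ (i + 1)).re : ℝ) : ℂ) with hS₁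
    set S₂ := ∑ i ∈ Finset.range ((p ^ k).natDegree + 1),
      (p ^ k).coeff i * ((Real.exp (-((i + 1 : ℕ) * T)) * (v ^ (i + 1)).im : ℝ) : ℂ) with hS₂
    have hS : w = S₁ + S₂ * Complex.I := by
      have h3 : w = w * (p ^ k).eval w := by simp [hpw]
      rw [h3, Polynomial.eval_eq_sum_range, hS₁, hS₂, Finset.sum_mul, ← Finset.sum_add_distrib,
        Finset.mul_sum]
      refine Finset.sum_congr rfl fun i _ => ?_
      have h4 : ((v ^ (i + 1)).re : ℂ) + (v ^ (i + 1)).im * Complex.I =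
          w ^ (i + 1) * Real.exp ((i + 1 : ℕ) * T) := by
        rw [Complex.re_add_im, hv, mul_pow, Real.exp_nat_mul, Complex.ofReal_pow]
      have h5 : ((Real.exp (-((i + 1 : ℕ) * T)) : ℝ) : ℂ) * Real.exp ((i + 1 : ℕ) * T) = 1 := by
        rw [← Complex.ofReal_mul, ← Real.exp_add]; simp
      rw [Complex.ofReal_mul, Complex.ofReal_mul]
      linear_combination (-(p ^ k).coeff i * w ^ (i + 1)) * h5 -
        (p ^ k).coeff i * (Real.exp (-((i + 1 : ℕ) * T)) : ℂ) * h4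
    calc ‖w‖ ≤ ‖S₁‖ + ‖S₂ * Complex.I‖ := by
          conv_lhs => rw [hS]
          exact norm_add_le _ _
      _ ≤ (C₁ + C₂) * (1 / 2) ^ k := by
          rw [norm_mul, Complex.norm_I, mul_one]; linarith
  have hlim : Filter.Tendsto (fun k : ℕ => (C₁ + C₂) * (1 / 2 : ℝ) ^ k) Filter.atTop (nhds 0) := by
    simpa using (tendsto_pow_atTop_nhds_zero_of_lt_one (by norm_num : (0 : ℝ) ≤ 1 / 2)
      (by norm_num)).const_mul (C₁ + C₂)
  exact hw0 (norm_le_zero_iff.1 (ge_of_tendsto' hlim key))
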